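/- Let $X$ be a non-degenerate real random variable such that $\varphi(t):=\log\mathbb E[e^{tX}]$ is finite for all $t\ge 0$. Let $I(\beta)=\sup_{t\ge 0}(\beta t-\varphi(t))$ and put $c_2:=I(\varphi'(2))=2\varphi'(2)-\varphi(2)$. Let $\{X_{i,j}:(i,j)\in\mathbb N^2\}$ be an array of independent copies of $X$, let $\{N_n\}_{n\in\mathbb N}$ be a sequence of natural numbers such that $\lim_{n\to\infty}e^{-cn}N_n=1$ for some $c>0$, and set $$Z_n=\sum_{i=1}^{N_n}\prod_{j=1}^{n}e^{X_{i,j}}.$$ If $c=c_2$, then each $Z_n$ is square-integrable, $\operatorname{Var}Z_n>0$ for all sufficiently large $n$, and $$\frac{Z_n-\mathbb E Z_n}{\sqrt{\operatorname{Var}Z_n}}\ \longrightarrow\ \mathcal N(0,1/2)\quad\text{in distribution as } n\to\infty,$$ where $\mathcal N(0,1/2)$ is the normal law with mean $0$ and variance $1/2$. -/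

import Mathlib

open MeasureTheory ProbabilityTheory Filter Topology

/-- The Legendre-Fenchel transform `I(β) = sup_{t ≥ 0} (β t - φ(t))` of the cumulant generating
function `φ(t) = log E[exp (t ξ)]` of a real random variable `ξ`, with values in the extended
reals. -/
noncomputable def rateFunction {Ω : Type*} [MeasurableSpace Ω] (ξ : Ω → ℝ) (μ : Measure Ω)
    (β : ℝ) : EReal :=
  ⨆ t : {t : ℝ // 0 ≤ t}, ((β * t - cgf ξ μ t : ℝ) : EReal)

/-- The critical point `c₂ = I(φ'(2))`. -/
noncomputable def criticalPointTwo {Ω : Type*} [MeasurableSpace Ω] (ξ : Ω → ℝ) (μ : Measure Ω) :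
    EReal :=
  rateFunction ξ μ (deriv (cgf ξ μ) 2)

/-- The sum of random products `Z_n = ∑_{i ≤ N_n} ∏_{j ≤ n} exp (X_{i,j})`. The rows and the columns
of the array are numbered from `0`, so that `X i j` is the entry in row `i + 1` and column
`j + 1`. -/
noncomputable def sumOfProducts {Ω : Type*} (X : ℕ → ℕ → Ω → ℝ) (N : ℕ → ℕ) (n : ℕ) (ω : Ω) : ℝ :=
  ∑ i ∈ Finset.range (N n), ∏ j ∈ Finset.range n, Real.exp (X i j ω)

/-! Let s be the standard deviation of Z_n and R a row product. The characteristic function of R at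
t/s is 1 + iθ + k, where θ = t E[R]/s and k is the mean of e^{iy} - 1 - iy at y = tR/s. Centring
multiplies each factor by e^{-iθ}, and the N_n-th power tends to e^w once N_n θ² → 0 and N_n k → w
(`tendsto_exp_neg_mul_one_add_pow`). The first condition holds because (E R)²/E[R²] = r^n, where r <
1 by non-degeneracy.

For the second, tilting each step by e^{2x} turns k into (E[R²]/s²) E[h(S_n - log s)]
(`charFun_map_rowProduct`). Here S_n is a random walk with tilted steps of mean m = φ'(2), and h(x)
= (e^{iy} - 1 - iy)/e^{2x} at y = te^x is bounded, with limits -t²/2 at -∞ and 0 at +∞. The value c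
= 2m - φ(2) is exactly the one that makes log s = nm + o(1) (`tendsto_mul_sub_log_sqrt`). By the
central limit theorem S_n - log s is then far to the left or far to the right, each with limiting
probability 1/2 (`tendsto_integral_comp_sum_sub`). Since N_n E[R²]/s² → 1, this gives w = -t²/4.

Half of the variance comes from rows small compared with s, which produce the Gaussian limit; the
other half comes from rare large rows, which are lost in the limit. -/

/-! ### Taylor estimates for the exponential on the imaginary axis -/

/-- The second order remainder of the exponential. -/
noncomputable def expRemainder (z : ℂ) : ℂ := Complex.exp z - 1 - z

lemma continuous_expRemainder : Continuous expRemainder := by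
  unfold expRemainder; fun_prop

lemma norm_expRemainder_ofReal_mul_I_le_add (y : ℝ) : ‖expRemainder (y * Complex.I)‖ ≤ 2 + |y| := by
  unfold expRemainder
  calc ‖Complex.exp (y * Complex.I) - 1 - y * Complex.I‖
      ≤ ‖Complex.exp (y * Complex.I)‖ + ‖(1 : ℂ)‖ + ‖(y : ℂ) * Complex.I‖ :=
        (norm_sub_le _ _).trans (by gcongr; exact norm_sub_le _ _)
    _ = 2 + |y| := by rw [Complex.norm_exp_ofReal_mul_I]; simp; norm_num

lemma norm_expRemainder_add_sq_div_two_le {y : ℝ} (hy : |y| ≤ 1) :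
    ‖expRemainder (y * Complex.I) + y ^ 2 / 2‖ ≤ |y| ^ 3 := by
  have h := Complex.exp_bound (x := y * Complex.I) (by simpa using hy) (n := 3) (by norm_num)
  have e : expRemainder (y * Complex.I) + y ^ 2 / 2 = Complex.exp (y * Complex.I) -
      ∑ m ∈ Finset.range 3, (y * Complex.I) ^ m / (m.factorial : ℂ) := by
    simp [Finset.sum_range_succ, expRemainder, mul_pow, Nat.factorial]
    ring
  rw [e]
  refine h.trans ?_
  simp only [norm_mul, Complex.norm_real, Complex.norm_I, mul_one, Real.norm_eq_abs]
  have : (Nat.succ 3 : ℝ) * (((3 : ℕ).factorial : ℝ) * (3 : ℕ))⁻¹ ≤ 1 := by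
    norm_num [Nat.factorial]
  nlinarith [pow_nonneg (abs_nonneg y) 3]

/-- Taylor's formula covers |y| ≤ 1. Beyond that the linear bound suffices, and 3 is chosen so that
2 + |y| ≤ 3y² there. -/
lemma norm_expRemainder_ofReal_mul_I_le (y : ℝ) :
    ‖expRemainder (y * Complex.I)‖ ≤ 3 * y ^ 2 := by
  rcases le_total |y| 1 with hy | hy
  · have h := norm_expRemainder_add_sq_div_two_le hy
    have h2 : ‖expRemainder (y * Complex.I)‖ ≤
        ‖expRemainder (y * Complex.I) + y ^ 2 / 2‖ + ‖((y : ℂ) ^ 2 / 2)‖ := by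
      have := norm_sub_le (expRemainder (y * Complex.I) + y ^ 2 / 2) ((y : ℂ) ^ 2 / 2)
      rwa [add_sub_cancel_right] at this
    have h3 : ‖((y : ℂ) ^ 2 / 2)‖ = y ^ 2 / 2 := by simp
    have h4 : |y| ^ 3 ≤ y ^ 2 := by
      rw [← sq_abs y]
      exact pow_le_pow_of_le_one (abs_nonneg y) hy (by norm_num)
    nlinarith
  · have h := norm_expRemainder_ofReal_mul_I_le_add y
    nlinarith [sq_abs y]

/-- The remainder of the exponential at `i t e ^ x`, divided by the square of `e ^ x`. -/
noncomputable def scaledExpRemainder (t x : ℝ) : ℂ :=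
  expRemainder ((t * Real.exp x : ℝ) * Complex.I) / (Real.exp (2 * x) : ℝ)

lemma continuous_scaledExpRemainder (t : ℝ) : Continuous (scaledExpRemainder t) := by
  unfold scaledExpRemainder
  refine Continuous.div (continuous_expRemainder.comp (by fun_prop)) (by fun_prop) fun x => ?_
  exact_mod_cast (Real.exp_pos _).ne'

lemma exp_two_mul_eq_sq (x : ℝ) : Real.exp (2 * x) = Real.exp x ^ 2 := by
  rw [← Real.exp_nat_mul]; norm_num

lemma norm_scaledExpRemainder_le (t x : ℝ) : ‖scaledExpRemainder t x‖ ≤ 3 * t ^ 2 := by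
  unfold scaledExpRemainder
  rw [norm_div, Complex.norm_real, Real.norm_of_nonneg (Real.exp_pos _).le,
    div_le_iff₀ (Real.exp_pos _), exp_two_mul_eq_sq]
  refine (norm_expRemainder_ofReal_mul_I_le _).trans (le_of_eq (by ring))

/-- The quadratic Taylor term gives the limit; the cubic error, once divided by e^{2x}, is at most
|t|³e^x. -/
lemma tendsto_scaledExpRemainder_atBot (t : ℝ) :
    Tendsto (scaledExpRemainder t) atBot (𝓝 (-t ^ 2 / 2)) := by
  have h0 : Tendsto (fun x => t * Real.exp x) atBot (𝓝 0) := by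
    simpa using Real.tendsto_exp_atBot.const_mul t
  have hb : ∀ᶠ x in atBot, |t * Real.exp x| ≤ 1 := by
    have := h0.abs
    simp only [abs_zero] at this
    exact this.eventually_le_const one_pos
  rw [tendsto_iff_norm_sub_tendsto_zero]
  have hlim : Tendsto (fun x => |t| ^ 3 * Real.exp x) atBot (𝓝 0) := by
    simpa using Real.tendsto_exp_atBot.const_mul (|t| ^ 3)
  refine squeeze_zero' (Eventually.of_forall fun _ => norm_nonneg _) ?_ hlim
  filter_upwards [hb] with x hx
  have hne : (Real.exp x : ℂ) ≠ 0 := by exact_mod_cast (Real.exp_pos x).ne'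
  have e : scaledExpRemainder t x - -(t : ℂ) ^ 2 / 2 =
      (expRemainder ((t * Real.exp x : ℝ) * Complex.I) + ((t * Real.exp x : ℝ) : ℂ) ^ 2 / 2) /
        ((Real.exp x ^ 2 : ℝ) : ℂ) := by
    unfold scaledExpRemainder
    rw [exp_two_mul_eq_sq]
    push_cast
    push_cast at hne
    field_simp
    ring
  rw [e, norm_div, Complex.norm_real, Real.norm_of_nonneg (by positivity),
    div_le_iff₀ (by positivity)]
  refine (norm_expRemainder_add_sq_div_two_le hx).trans (le_of_eq ?_)
  rw [abs_mul, abs_of_pos (Real.exp_pos x)]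
  ring

/-- The remainder grows at most linearly in e^x, so division by e^{2x} kills it. -/
lemma tendsto_scaledExpRemainder_atTop (t : ℝ) :
    Tendsto (scaledExpRemainder t) atTop (𝓝 0) := by
  have hlim : Tendsto (fun x => (2 + |t|) * Real.exp (-x)) atTop (𝓝 0) := by
    simpa using (Real.tendsto_exp_neg_atTop_nhds_zero).const_mul (2 + |t|)
  refine squeeze_zero_norm' ?_ hlim
  filter_upwards [eventually_ge_atTop 0] with x hx
  have h1 : 1 ≤ Real.exp x := Real.one_le_exp hx
  unfold scaledExpRemainder
  rw [norm_div, Complex.norm_real, Real.norm_of_nonneg (Real.exp_pos _).le,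
    div_le_iff₀ (Real.exp_pos _)]
  refine (norm_expRemainder_ofReal_mul_I_le_add _).trans ?_
  rw [exp_two_mul_eq_sq, Real.exp_neg, abs_mul, abs_of_pos (Real.exp_pos x)]
  field_simp
  nlinarith [abs_nonneg t]

/-- If `N n * g n → w` and `N n → ∞`, then `(1 + g n) ^ N n → exp w`. -/
lemma Complex.tendsto_one_add_pow_exp {N : ℕ → ℕ} {g : ℕ → ℂ} {w : ℂ}
    (hN : Tendsto N atTop atTop) (hg : Tendsto (fun n => (N n : ℂ) * g n) atTop (𝓝 w)) :
    Tendsto (fun n => (1 + g n) ^ N n) atTop (𝓝 (Complex.exp w)) := by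
  have hinv : Tendsto (fun n => ((N n : ℂ))⁻¹) atTop (𝓝 0) :=
    (tendsto_inv_atTop_nhds_zero_nat (𝕜 := ℂ)).comp hN
  have hg0 : Tendsto g atTop (𝓝 0) := by
    have := hinv.mul hg
    rw [zero_mul] at this
    refine this.congr' ?_
    filter_upwards [hN.eventually_ne_atTop 0] with n hn
    rw [inv_mul_cancel_left₀ (by exact_mod_cast hn)]
  have hd : HasDerivAt (fun z : ℂ => Complex.log (1 + z)) 1 0 := by
    have := ((hasDerivAt_id (0 : ℂ)).const_add 1).clog (by simp)
    simpa using this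
  -- The slope of log(1 + z), extended continuously by 1 at z = 0, allows writing log(1 + z) = z ·
  -- slope without dividing by z.
  have hcont : Tendsto (dslope (fun z : ℂ => Complex.log (1 + z)) 0) (𝓝 0) (𝓝 1) := by
    have := (continuousAt_dslope_same.2 hd.differentiableAt).tendsto
    rwa [dslope_same, hd.deriv] at this
  have hlog : ∀ z : ℂ, Complex.log (1 + z) =
      z * dslope (fun z : ℂ => Complex.log (1 + z)) 0 z := fun z => by
    simpa using (sub_smul_dslope (fun z : ℂ => Complex.log (1 + z)) 0 z).symm
  have hmain := (Complex.continuous_exp.tendsto w).comp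
    ((hg.mul (hcont.comp hg0)).trans (by simp))
  refine hmain.congr' ?_
  have hne : ∀ᶠ n in atTop, g n ≠ -1 := hg0.eventually_ne (by simp)
  filter_upwards [hne] with n hn
  have h1 : 1 + g n ≠ 0 := fun h => hn (by linear_combination h)
  simp only [Function.comp]
  rw [mul_assoc, ← hlog, Complex.exp_nat_mul, Complex.exp_log h1]

/-! ### Weak convergence under expanding dilations -/

section Step

variable {P : ℕ → ProbabilityMeasure ℝ} {P₀ : ProbabilityMeasure ℝ}

lemma tendsto_measureReal_of_null_frontier (h : Tendsto P atTop (𝓝 P₀)) {s : Set ℝ}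
    (hs : (P₀ : Measure ℝ) (frontier s) = 0) :
    Tendsto (fun n => (P n : Measure ℝ).real s) atTop (𝓝 ((P₀ : Measure ℝ).real s)) :=
  (ENNReal.tendsto_toReal (measure_ne_top _ _)).comp
    (ProbabilityMeasure.tendsto_measure_of_null_frontier_of_tendsto' h hs)

/-- Off a small ball around 0 the dilation sends the argument to where H is small. On the ball H is
bounded, and the mass there is small because the limit law has no atom at 0. -/
lemma tendsto_integral_comp_mul_of_tendsto_zero (hP₀ : NullSingletonClass (P₀ : Measure ℝ))
    (h : Tendsto P atTop (𝓝 P₀)) {a : ℕ → ℝ} (ha : Tendsto a atTop atTop) {H : ℝ → ℂ} {C : ℝ}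
    (hC : ∀ x, ‖H x‖ ≤ C) (hbot : Tendsto H atBot (𝓝 0)) (htop : Tendsto H atTop (𝓝 0)) :
    Tendsto (fun n => ∫ x, H (a n * x) ∂(P n : Measure ℝ)) atTop (𝓝 0) := by
  have hC0 : 0 ≤ C := (norm_nonneg _).trans (hC 0)
  rw [NormedAddGroup.tendsto_nhds_zero]
  intro ε hε
  obtain ⟨δ, hδ, hδε⟩ : ∃ δ > 0, C * (P₀ : Measure ℝ).real (Metric.closedBall 0 δ) < ε / 2 := by
    have h1 := tendsto_measure_cthickening_of_isCompact (μ := (P₀ : Measure ℝ))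
      (isCompact_singleton (x := (0 : ℝ)))
    have h2 := ((ENNReal.tendsto_toReal (measure_ne_top _ _)).comp h1).const_mul C
    simp only [measure_singleton, ENNReal.toReal_zero, mul_zero] at h2
    have h3 := (h2.mono_left (nhdsWithin_le_nhds (s := Set.Ioi 0))).eventually_lt_const
      (half_pos hε)
    obtain ⟨δ, h4, hδ⟩ := (h3.and self_mem_nhdsWithin).exists
    refine ⟨δ, hδ, ?_⟩
    simpa [Metric.cthickening_singleton _ (le_of_lt hδ), Measure.real] using h4
  have hfr : (P₀ : Measure ℝ) (frontier (Metric.closedBall 0 δ)) = 0 := by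
    rw [frontier_closedBall _ hδ.ne', Real.sphere_eq_pair _ hδ.le]
    exact (Set.toFinite _).measure_zero _
  have hball := ((tendsto_measureReal_of_null_frontier h hfr).const_mul C).eventually_lt_const hδε
  obtain ⟨K₁, hK₁⟩ := eventually_atBot.1
    ((NormedAddGroup.tendsto_nhds_zero.1 hbot) (ε / 2) (half_pos hε))
  obtain ⟨K₂, hK₂⟩ := eventually_atTop.1
    ((NormedAddGroup.tendsto_nhds_zero.1 htop) (ε / 2) (half_pos hε))
  have haK : ∀ᶠ n in atTop, max (-K₁) K₂ ≤ a n * δ :=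
    (ha.atTop_mul_const hδ).eventually_ge_atTop _
  filter_upwards [hball, haK, ha.eventually_gt_atTop 0] with n hn hnK hn0
  have hbound : ∀ x, ‖H (a n * x)‖ ≤
      ε / 2 + (Metric.closedBall (0 : ℝ) δ).indicator (fun _ => C) x := fun x => by
    by_cases hx : x ∈ Metric.closedBall (0 : ℝ) δ
    · rw [Set.indicator_of_mem hx]
      linarith [hC (a n * x)]
    · rw [Set.indicator_of_notMem hx, add_zero]
      rw [mem_closedBall_zero_iff, Real.norm_eq_abs, not_le, lt_abs] at hx
      rcases hx with hx | hx
      · exact (hK₂ _ ((le_max_right _ _).trans (hnK.trans (by gcongr)))).le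
      · refine (hK₁ _ ?_).le
        have := (le_max_left (-K₁) K₂).trans (hnK.trans
          (mul_le_mul_of_nonneg_left hx.le hn0.le))
        linarith
  have hind : Integrable ((Metric.closedBall (0 : ℝ) δ).indicator (fun _ => C))
      (P n : Measure ℝ) := (integrable_const C).indicator Metric.isClosed_closedBall.measurableSet
  calc ‖∫ x, H (a n * x) ∂(P n : Measure ℝ)‖
      ≤ ∫ x, (ε / 2 + (Metric.closedBall (0 : ℝ) δ).indicator (fun _ => C) x) ∂(P n : Measure ℝ) :=
        norm_integral_le_of_norm_le ((integrable_const _).add hind)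
          (Eventually.of_forall hbound)
    _ = ε / 2 + C * (P n : Measure ℝ).real (Metric.closedBall 0 δ) := by
        rw [integral_add (integrable_const _) hind,
          integral_indicator_const _ Metric.isClosed_closedBall.measurableSet]
        simp [mul_comm]
    _ < ε := by linarith

/-- If `P n → P₀` weakly, `P₀` has no atoms and `a n → ∞`, then the integral of `G (a n * x)` only
sees the limits of `G` at `±∞`. -/
lemma tendsto_integral_comp_mul_of_tendsto (hP₀ : NullSingletonClass (P₀ : Measure ℝ))
    (h : Tendsto P atTop (𝓝 P₀)) {a : ℕ → ℝ} (ha : Tendsto a atTop atTop) {G : ℝ → ℂ} {C : ℝ}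
    {A B : ℂ} (hG : Measurable G) (hC : ∀ x, ‖G x‖ ≤ C) (hbot : Tendsto G atBot (𝓝 A))
    (htop : Tendsto G atTop (𝓝 B)) :
    Tendsto (fun n => ∫ x, G (a n * x) ∂(P n : Measure ℝ)) atTop
      (𝓝 ((P₀ : Measure ℝ).real (Set.Iio 0) * A + (P₀ : Measure ℝ).real (Set.Ici 0) * B)) := by
  -- This step function has the limits of G and is invariant under positive dilations, so its
  -- integrals need only the masses of the two half-lines.
  set S : ℝ → ℂ := fun x => (Set.Iio (0 : ℝ)).indicator (fun _ => A) x +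
    (Set.Ici (0 : ℝ)).indicator (fun _ => B) x with hS
  have hSneg : ∀ x < 0, S x = A := fun x hx => by simp [hS, hx]
  have hSpos : ∀ x, 0 ≤ x → S x = B := fun x hx => by simp [hS, hx]
  have hSm : Measurable S := (measurable_const.indicator measurableSet_Iio).add
    (measurable_const.indicator measurableSet_Ici)
  have hSb : ∀ x, ‖S x‖ ≤ ‖A‖ + ‖B‖ := fun x => by
    rcases lt_or_ge x 0 with hx | hx
    · rw [hSneg x hx]; linarith [norm_nonneg B]
    · rw [hSpos x hx]; linarith [norm_nonneg A]
  have hSbot : Tendsto S atBot (𝓝 A) := tendsto_const_nhds.congr' <| by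
    filter_upwards [eventually_lt_atBot 0] with x hx using (hSneg x hx).symm
  have hStop : Tendsto S atTop (𝓝 B) := tendsto_const_nhds.congr' <| by
    filter_upwards [eventually_ge_atTop 0] with x hx using (hSpos x hx).symm
  have hzero := tendsto_integral_comp_mul_of_tendsto_zero hP₀ h ha (H := fun x => G x - S x)
    (C := C + (‖A‖ + ‖B‖))
    (fun x => (norm_sub_le _ _).trans (add_le_add (hC x) (hSb x)))
    (by simpa using hbot.sub hSbot) (by simpa using htop.sub hStop)
  have hneg := tendsto_measureReal_of_null_frontier h (s := Set.Iio 0) (by simp)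
  have hpos := tendsto_measureReal_of_null_frontier h (s := Set.Ici 0) (by simp)
  have hstep := ((Complex.continuous_ofReal.tendsto _).comp hneg |>.mul_const A).add
    ((Complex.continuous_ofReal.tendsto _).comp hpos |>.mul_const B)
  have hsum := hzero.add hstep
  rw [zero_add] at hsum
  refine hsum.congr' ?_
  filter_upwards [ha.eventually_gt_atTop 0] with n hn
  have hi : ∀ {f : ℝ → ℂ} {D : ℝ}, Measurable f → (∀ x, ‖f x‖ ≤ D) →
      Integrable f (P n : Measure ℝ) := fun hf hD =>
    Integrable.of_bound hf.aestronglyMeasurable _ (Eventually.of_forall hD)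
  have hSn : ∀ x, S (a n * x) = S x := fun x => by
    rcases lt_or_ge x 0 with hx | hx
    · rw [hSneg x hx, hSneg _ (mul_neg_of_pos_of_neg hn hx)]
    · rw [hSpos x hx, hSpos _ (mul_nonneg hn.le hx)]
  have hSint : ∫ x, S x ∂(P n : Measure ℝ) =
      (P n : Measure ℝ).real (Set.Iio 0) * A + (P n : Measure ℝ).real (Set.Ici 0) * B := by
    rw [hS, integral_add ((integrable_const _).indicator measurableSet_Iio)
      ((integrable_const _).indicator measurableSet_Ici),
      integral_indicator_const _ measurableSet_Iio, integral_indicator_const _ measurableSet_Ici]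
    simp
  simp only [hSn, Function.comp_def]
  rw [integral_sub (hi (by fun_prop) fun x => hC _) (hi hSm hSb), hSint, sub_add_cancel]

end Step

/-! ### Gaussian half-lines and the unrescaled random walk -/

lemma measureReal_gaussianReal_Iio {v : NNReal} (hv : v ≠ 0) :
    (gaussianReal 0 v).real (Set.Iio 0) = 1 / 2 := by
  have := nullSingletonClass_gaussianReal (μ := 0) hv
  have h1 : (gaussianReal 0 v).real (Set.Iio 0) = (gaussianReal 0 v).real (Set.Ioi 0) := by
    have h2 := gaussianReal_map_neg (μ := 0) (v := v)
    rw [neg_zero] at h2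
    conv_lhs => rw [← h2]
    rw [map_measureReal_apply measurable_neg measurableSet_Iio]
    simp
  have h3 := measureReal_compl (μ := gaussianReal 0 v) (measurableSet_Iio (a := (0 : ℝ)))
  rw [Set.compl_Iio, ← Set.Ioi_union_left, measureReal_union (by simp) (by simp), ← h1] at h3
  simp [Measure.real] at h3 ⊢
  linarith

lemma measureReal_gaussianReal_Ici {v : NNReal} (hv : v ≠ 0) :
    (gaussianReal 0 v).real (Set.Ici 0) = 1 / 2 := by
  rw [← Set.compl_Iio, measureReal_compl measurableSet_Iio, measureReal_gaussianReal_Iio hv]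
  simp
  norm_num

/-- Under the central limit theorem, a function of a drifting, non-rescaled centred random walk
averages its limits at `±∞`. -/
lemma tendsto_integral_comp_sum_sub {Ω : Type*} [MeasurableSpace Ω] {μ : Measure Ω}
    [IsProbabilityMeasure μ] {Y : ℕ → Ω → ℝ} (hY : MemLp (Y 0) 2 μ) (hvar : Var[Y 0; μ] ≠ 0)
    (hindep : iIndepFun Y μ) (hident : ∀ i, IdentDistrib (Y i) (Y 0) μ μ) {b : ℕ → ℝ}
    (hb : Tendsto (fun n => n * μ[Y 0] - b n) atTop (𝓝 0)) {G : ℝ → ℂ} {C : ℝ} {A B : ℂ}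
    (hG : Measurable G) (hC : ∀ x, ‖G x‖ ≤ C) (hbot : Tendsto G atBot (𝓝 A))
    (htop : Tendsto G atTop (𝓝 B)) :
    Tendsto (fun n => ∫ ω, G (∑ k ∈ Finset.range n, Y k ω - b n) ∂μ) atTop
      (𝓝 ((A + B) / 2)) := by
  set v := Var[Y 0; μ].toNNReal with hv
  have hv0 : v ≠ 0 := by
    rw [hv, Ne, Real.toNNReal_eq_zero, not_le]
    exact (variance_nonneg _ _).lt_of_ne' hvar
  have hclt := tendstoInDistribution_inv_sqrt_mul_sum_sub (HasLaw.id (μ := gaussianReal 0 v))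
    hY hindep hident
  have hsqrt : Tendsto (fun n : ℕ => √(n : ℝ)) atTop atTop :=
    Real.tendsto_sqrt_atTop.comp tendsto_natCast_atTop_atTop
  have hdrift : Tendsto (fun n : ℕ => (√(n : ℝ))⁻¹ * (n * μ[Y 0] - b n)) atTop (𝓝 0) := by
    simpa using (tendsto_inv_atTop_zero.comp hsqrt).mul hb
  -- Slutsky: the vanishing deterministic drift changes the centring n E[Y] of the central limit
  -- theorem into b n.
  have hslutsky := hclt.continuous_comp_prodMk_of_tendstoInMeasure_const
    (g := fun p : ℝ × ℝ => p.1 + p.2) (by fun_prop)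
    (tendstoInMeasure_of_tendsto_ae (μ := μ)
      (f := fun n _ => (√(n : ℝ))⁻¹ * (n * μ[Y 0] - b n)) (g := fun _ => (0 : ℝ))
      (fun _ => aestronglyMeasurable_const) (Eventually.of_forall fun _ => hdrift))
    (fun _ => aemeasurable_const)
  have hmeas := hslutsky.forall_aemeasurable
  have hlim := hslutsky.tendsto
  simp only [id, add_zero, Measure.map_id'] at hlim
  have key := tendsto_integral_comp_mul_of_tendsto
    (P₀ := ⟨gaussianReal 0 v, inferInstance⟩) (nullSingletonClass_gaussianReal hv0)
    hlim hsqrt hG hC hbot htop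
  simp only [ProbabilityMeasure.coe_mk, measureReal_gaussianReal_Iio hv0,
    measureReal_gaussianReal_Ici hv0] at key
  have e : ((1 / 2 : ℝ) : ℂ) * A + ((1 / 2 : ℝ) : ℂ) * B = (A + B) / 2 := by
    push_cast; ring
  rw [e] at key
  refine key.congr' ?_
  filter_upwards [eventually_gt_atTop 0] with n hn
  have hGn : Measurable fun x => G (√(n : ℝ) * x) := hG.comp (measurable_const_mul _)
  rw [integral_map (hmeas n) hGn.aestronglyMeasurable]
  refine integral_congr_ae (Eventually.of_forall fun ω => ?_)
  have hs : √(n : ℝ) ≠ 0 := (Real.sqrt_pos.2 (by exact_mod_cast hn)).ne'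
  simp only
  congr 1
  field_simp
  ring

/-! ### Exponential tilting of sums -/

section Tilting

/-- A density that factors along addition passes through convolution; exponentials do, which is why
tilting preserves independent sums. -/
lemma conv_withDensity {μ ν : Measure ℝ} [SFinite μ] [SFinite ν] {f g h : ℝ → ENNReal}
    (hf : Measurable f) (hg : Measurable g) (hh : Measurable h)
    (hfg : ∀ x y, h (x + y) = f x * g y) :
    (μ.withDensity f) ∗ (ν.withDensity g) = (μ ∗ ν).withDensity h := by
  refine Measure.ext_of_lintegral _ fun F hF => ?_
  rw [Measure.lintegral_conv hF, lintegral_withDensity_eq_lintegral_mul _ hh hF,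
    Measure.lintegral_conv (hh.mul hF), lintegral_withDensity_eq_lintegral_mul _ hf (by fun_prop)]
  refine lintegral_congr fun x => ?_
  rw [Pi.mul_apply, lintegral_withDensity_eq_lintegral_mul _ hg (by fun_prop),
    ← lintegral_const_mul _ (by fun_prop)]
  refine lintegral_congr fun y => ?_
  simp only [Pi.mul_apply, hfg, mul_assoc]

variable {Ω Ω' : Type*} [MeasurableSpace Ω] [MeasurableSpace Ω'] {μ : Measure Ω} {μ' : Measure Ω'}
  [IsProbabilityMeasure μ] [IsProbabilityMeasure μ'] {Y : ℕ → Ω → ℝ} {Y' : ℕ → Ω' → ℝ} {θ κ : ℝ}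

lemma map_zero_eq_dirac : μ.map (0 : Ω → ℝ) = Measure.dirac 0 := by
  change μ.map (fun _ => (0 : ℝ)) = _
  rw [Measure.map_const, measure_univ, one_smul]

/-- The exponential tilting of the law of a sum of independent variables is the law of the sum of
independent variables with tilted laws. -/
lemma withDensity_map_sum_range (hY : iIndepFun Y μ) (hYm : ∀ j, AEMeasurable (Y j) μ)
    (hY' : iIndepFun Y' μ') (hYm' : ∀ j, AEMeasurable (Y' j) μ')
    (h : ∀ j, (μ.map (Y j)).withDensity (fun x => ENNReal.ofReal (Real.exp (θ * x - κ))) =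
      μ'.map (Y' j)) (n : ℕ) :
    (μ.map (∑ j ∈ Finset.range n, Y j)).withDensity
      (fun x => ENNReal.ofReal (Real.exp (θ * x - n * κ))) =
      μ'.map (∑ j ∈ Finset.range n, Y' j) := by
  induction n with
  | zero =>
    rw [Finset.sum_range_zero, Finset.sum_range_zero, map_zero_eq_dirac, map_zero_eq_dirac]
    refine Measure.ext_of_lintegral _ fun F hF => ?_
    rw [lintegral_withDensity_eq_lintegral_mul _ (by fun_prop) hF, lintegral_dirac' _ hF,
      lintegral_dirac' _ (Measurable.mul (by fun_prop) hF)]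
    simp
  | succ n ih =>
    rw [Finset.sum_range_succ, Finset.sum_range_succ,
      (hY.indepFun_sum_range_succ₀ hYm n).map_add_eq_map_conv_map₀
        (Finset.aemeasurable_sum _ fun j _ => hYm j) (hYm n),
      (hY'.indepFun_sum_range_succ₀ hYm' n).map_add_eq_map_conv_map₀
        (Finset.aemeasurable_sum _ fun j _ => hYm' j) (hYm' n), ← ih, ← h n]
    refine (conv_withDensity (by fun_prop) (by fun_prop) (by fun_prop) fun x y => ?_).symm
    rw [← ENNReal.ofReal_mul (Real.exp_pos _).le, ← Real.exp_add]
    push_cast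
    ring_nf

lemma integral_exp_smul_sum_range (hY : iIndepFun Y μ) (hYm : ∀ j, AEMeasurable (Y j) μ)
    (hY' : iIndepFun Y' μ') (hYm' : ∀ j, AEMeasurable (Y' j) μ')
    (h : ∀ j, (μ.map (Y j)).withDensity (fun x => ENNReal.ofReal (Real.exp (θ * x - κ))) =
      μ'.map (Y' j)) (n : ℕ) {G : ℝ → ℂ} (hG : Measurable G) :
    ∫ ω, Real.exp (θ * (∑ j ∈ Finset.range n, Y j ω) - n * κ) •
        G (∑ j ∈ Finset.range n, Y j ω) ∂μ =
      ∫ ω, G (∑ j ∈ Finset.range n, Y' j ω) ∂μ' := by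
  have h1 := congrArg (fun ρ : Measure ℝ => ∫ x, G x ∂ρ)
    (withDensity_map_sum_range hY hYm hY' hYm' h n)
  rw [integral_withDensity_eq_integral_toReal_smul (by fun_prop) (by simp),
    integral_map (Finset.aemeasurable_sum _ fun j _ => hYm j)
      (Measurable.aestronglyMeasurable (by fun_prop)),
    integral_map (Finset.aemeasurable_sum _ fun j _ => hYm' j) hG.aestronglyMeasurable] at h1
  simpa [ENNReal.toReal_ofReal (Real.exp_pos _).le] using h1

end Tilting

/-! ### Independence of the rows -/

/-- The product `∏_{j < n} exp (X_{i,j})`. -/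
noncomputable def rowProduct {Ω : Type*} (X : ℕ → ℕ → Ω → ℝ) (n i : ℕ) (ω : Ω) : ℝ :=
  Real.exp (∑ j ∈ Finset.range n, X i j ω)

lemma sumOfProducts_eq_sum_rowProduct {Ω : Type*} (X : ℕ → ℕ → Ω → ℝ) (N : ℕ → ℕ) (n : ℕ) :
    sumOfProducts X N n = fun ω => ∑ i ∈ Finset.range (N n), rowProduct X n i ω := by
  ext ω
  simp [sumOfProducts, rowProduct, Real.exp_sum]

section Rows

variable {Ω : Type*} [MeasurableSpace Ω] {μ : Measure Ω} {X : ℕ → ℕ → Ω → ℝ}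

lemma indepFun_sum_rowProduct (hX : iIndepFun (fun p : ℕ × ℕ => X p.1 p.2) μ)
    (hXm : ∀ i j, AEMeasurable (X i j) μ)
    (n : ℕ) {s : Finset ℕ} {k : ℕ} (hk : k ∉ s) :
    IndepFun (fun ω => ∑ i ∈ s, rowProduct X n i ω) (rowProduct X n k) μ := by
  have hdisj : Disjoint (s ×ˢ Finset.range n) (({k} : Finset ℕ) ×ˢ Finset.range n) := by
    rw [Finset.disjoint_left]
    rintro ⟨a, b⟩ h1 h2
    simp only [Finset.mem_product, Finset.mem_singleton] at h1 h2
    exact hk (h2.1 ▸ h1.1)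
  have h := hX.indepFun_finset₀ _ _ hdisj fun p => hXm p.1 p.2
  have h2 := h.comp
    (φ := fun x => ∑ i : s, Real.exp (∑ j : Finset.range n,
      x ⟨(i, j), Finset.mk_mem_product i.2 j.2⟩))
    (ψ := fun x => Real.exp (∑ j : Finset.range n,
      x ⟨(k, j), Finset.mk_mem_product (Finset.mem_singleton_self k) j.2⟩))
    (by fun_prop) (by fun_prop)
  convert! h2 using 1
  · ext ω
    simp only [Function.comp, rowProduct]
    rw [← Finset.sum_coe_sort s]
    refine Finset.sum_congr rfl fun i _ => ?_
    rw [← Finset.sum_coe_sort (Finset.range n)]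
  · ext ω
    simp only [Function.comp, rowProduct]
    rw [← Finset.sum_coe_sort (Finset.range n)]

lemma indepFun_rowProduct (hX : iIndepFun (fun p : ℕ × ℕ => X p.1 p.2) μ)
    (hXm : ∀ i j, AEMeasurable (X i j) μ) (n : ℕ) {i k : ℕ} (hik : i ≠ k) :
    IndepFun (rowProduct X n i) (rowProduct X n k) μ := by
  simpa using indepFun_sum_rowProduct hX hXm n (s := {i}) (k := k) (by simpa using hik.symm)

lemma iIndepFun_row (hX : iIndepFun (fun p : ℕ × ℕ => X p.1 p.2) μ) (i : ℕ) : iIndepFun (X i) μ :=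
  hX.precomp (g := fun j => (i, j)) fun _ _ h => by simpa using h

lemma aemeasurable_rowProduct (hXm : ∀ i j, AEMeasurable (X i j) μ) (n i : ℕ) :
    AEMeasurable (rowProduct X n i) μ :=
  (Finset.aemeasurable_fun_sum _ fun j _ => hXm i j).exp

lemma charFun_map_sum_rowProduct [IsProbabilityMeasure μ]
    (hX : iIndepFun (fun p : ℕ × ℕ => X p.1 p.2) μ) (hXm : ∀ i j, AEMeasurable (X i j) μ)
    (n : ℕ) (s : Finset ℕ) (t : ℝ) :
    charFun (μ.map fun ω => ∑ i ∈ s, rowProduct X n i ω) t =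
      ∏ i ∈ s, charFun (μ.map (rowProduct X n i)) t := by
  induction s using Finset.induction_on with
  | empty => simp
  | insert k s hk ih =>
    have h := (indepFun_sum_rowProduct hX hXm n hk).charFun_map_fun_add_eq_mul
      (Finset.aemeasurable_fun_sum _ fun i _ => aemeasurable_rowProduct hXm n i)
      (aemeasurable_rowProduct hXm n k)
    rw [Finset.prod_insert hk, ← ih, mul_comm, ← Pi.mul_apply, ← h]
    simp only [Finset.sum_insert hk, add_comm]

end Rows

/-! ### Convexity of the cumulant generating function and the tilted law -/

section ExponentialMoments

variable {Ω : Type*} [MeasurableSpace Ω] {ν : Measure Ω} {ξ : Ω → ℝ}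

lemma mem_interior_integrableExpSet_of_pos
    (hξ : ∀ t : ℝ, 0 ≤ t → Integrable (fun ω => Real.exp (t * ξ ω)) ν) {t : ℝ} (ht : 0 < t) :
    t ∈ interior (integrableExpSet ξ ν) :=
  mem_interior.2 ⟨Set.Ioi 0, fun s hs => hξ s (le_of_lt hs), isOpen_Ioi, ht⟩

variable [IsProbabilityMeasure ν]

/-- This is the tangent line inequality for the convex function `cgf`, in exponential form. It is
Jensen's inequality for e^{(t-s)ξ} under the law tilted at s, whose mean is the derivative at s. -/
lemma exp_mul_mgf_le_mgf {s t : ℝ} (hs : s ∈ interior (integrableExpSet ξ ν))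
    (ht : Integrable (fun ω => Real.exp (t * ξ ω)) ν) :
    Real.exp ((t - s) * deriv (cgf ξ ν) s) * mgf ξ ν s ≤ mgf ξ ν t := by
  have hsi : Integrable (fun ω => Real.exp (s * ξ ω)) ν :=
    (interior_subset hs : s ∈ integrableExpSet ξ ν)
  have hpos : 0 < mgf ξ ν s := mgf_pos hsi
  have := isProbabilityMeasure_tilted hsi
  set m := deriv (cgf ξ ν) s
  have hξi : Integrable ξ (ν.tilted (s * ξ ·)) :=
    (memLp_tilted_mul hs 1).integrable (by simp)
  have hmean : ∫ ω, ξ ω ∂(ν.tilted (s * ξ ·)) = m := integral_tilted_mul_self hs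
  have hmul : ∀ ω, Real.exp (s * ξ ω) • Real.exp ((t - s) * ξ ω) = Real.exp (t * ξ ω) := fun ω => by
    rw [smul_eq_mul, ← Real.exp_add]; ring_nf
  have hei : Integrable (fun ω => Real.exp ((t - s) * ξ ω)) (ν.tilted (s * ξ ·)) := by
    rw [integrable_tilted_iff hsi]
    simpa only [hmul] using ht
  have hval : ∫ ω, Real.exp ((t - s) * ξ ω) ∂(ν.tilted (s * ξ ·)) = mgf ξ ν t / mgf ξ ν s := by
    rw [integral_tilted_mul_eq_mgf, mgf, mgf, ← integral_div]
    refine integral_congr_ae (Eventually.of_forall fun ω => ?_)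
    simp only [← hmul ω, smul_eq_mul]
    ring
  have hlin : Integrable (fun ω => (t - s) * (ξ ω - m)) (ν.tilted (s * ξ ·)) :=
    (hξi.sub (integrable_const m)).const_mul _
  have hle : ∫ ω, (Real.exp ((t - s) * m) * ((t - s) * (ξ ω - m) + 1)) ∂(ν.tilted (s * ξ ·)) ≤
      ∫ ω, Real.exp ((t - s) * ξ ω) ∂(ν.tilted (s * ξ ·)) := by
    refine integral_mono ((hlin.add (integrable_const _)).const_mul _) hei fun ω => ?_
    have e : Real.exp ((t - s) * ξ ω) =
        Real.exp ((t - s) * m) * Real.exp ((t - s) * (ξ ω - m)) := by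
      rw [← Real.exp_add]; ring_nf
    simp only [e]
    exact mul_le_mul_of_nonneg_left (Real.add_one_le_exp _) (Real.exp_pos _).le
  rw [integral_const_mul, integral_add hlin (integrable_const _), integral_const_mul,
    integral_sub hξi (integrable_const m), hmean, hval]
    at hle
  simp only [integral_const, probReal_univ, smul_eq_mul, one_mul, sub_self, mul_zero, zero_add,
    mul_one] at hle
  rwa [le_div_iff₀ hpos] at hle

/-- The supremum defining `I(φ'(2))` is attained at `2`. -/
lemma criticalPointTwo_eq
    (hξ : ∀ t : ℝ, 0 ≤ t → Integrable (fun ω => Real.exp (t * ξ ω)) ν) :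
    criticalPointTwo ξ ν = ((2 * deriv (cgf ξ ν) 2 - cgf ξ ν 2 : ℝ) : EReal) := by
  refine le_antisymm (iSup_le fun ⟨t, ht⟩ => ?_) (le_iSup_of_le ⟨2, zero_le_two⟩ ?_)
  · have h := exp_mul_mgf_le_mgf (mem_interior_integrableExpSet_of_pos hξ two_pos) (hξ t ht)
    rw [← exp_cgf (hξ t ht), ← exp_cgf (hξ 2 zero_le_two), ← Real.exp_add, Real.exp_le_exp] at h
    rw [EReal.coe_le_coe_iff]
    linarith
  · rw [EReal.coe_le_coe_iff, mul_comm]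

/-- The gap is the variance of e^ξ, which vanishes only if ξ is almost surely constant. -/
lemma mgf_one_sq_lt_mgf_two (hξ_nondeg : ¬ ∃ a : ℝ, ∀ᵐ ω ∂ν, ξ ω = a)
    (hξ : ∀ t : ℝ, 0 ≤ t → Integrable (fun ω => Real.exp (t * ξ ω)) ν) :
    mgf ξ ν 1 ^ 2 < mgf ξ ν 2 := by
  have hint : Integrable (fun ω => Real.exp (ξ ω) ^ 2) ν := by
    simpa only [exp_two_mul_eq_sq] using hξ 2 zero_le_two
  have hint1 : Integrable (fun ω => Real.exp (ξ ω)) ν := by simpa using hξ 1 zero_le_one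
  have hL : MemLp (fun ω => Real.exp (ξ ω)) 2 ν :=
    (memLp_two_iff_integrable_sq hint1.aestronglyMeasurable).2 hint
  have hvar := variance_eq_sub hL
  have hne : Var[fun ω => Real.exp (ξ ω); ν] ≠ 0 := fun h0 => by
    refine hξ_nondeg ⟨Real.log (∫ ω, Real.exp (ξ ω) ∂ν), ?_⟩
    filter_upwards [ae_eq_integral_of_variance_eq_zero hL h0] with ω hω
    rw [← hω, Real.log_exp]
  have hpos := (variance_nonneg _ _).lt_of_ne' hne
  rw [hvar] at hpos
  have e1 : mgf ξ ν 1 = ∫ ω, Real.exp (ξ ω) ∂ν := by simp [mgf]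
  have e2 : mgf ξ ν 2 = ∫ ω, Real.exp (ξ ω) ^ 2 ∂ν := by simp only [mgf, exp_two_mul_eq_sq]
  rw [e1, e2]
  exact sub_pos.1 hpos

/-- There is an independent sequence whose common law is the law of `ξ` tilted by `exp (2 x)`. -/
lemma exists_iid_tilted (hξ_nondeg : ¬ ∃ a : ℝ, ∀ᵐ ω ∂ν, ξ ω = a)
    (hξ : ∀ t : ℝ, 0 ≤ t → Integrable (fun ω => Real.exp (t * ξ ω)) ν) :
    ∃ (Ω' : Type) (_ : MeasurableSpace Ω') (P : Measure Ω') (Y : ℕ → Ω' → ℝ),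
      IsProbabilityMeasure P ∧ iIndepFun Y P ∧ (∀ j, AEMeasurable (Y j) P) ∧
      (∀ j, (ν.map ξ).withDensity (fun x => ENNReal.ofReal (Real.exp (2 * x - cgf ξ ν 2))) =
        P.map (Y j)) ∧
      MemLp (Y 0) 2 P ∧ Var[Y 0; P] ≠ 0 ∧ P[Y 0] = deriv (cgf ξ ν) 2 := by
  have h2 := mem_interior_integrableExpSet_of_pos hξ two_pos
  have hξm : AEMeasurable ξ ν := aemeasurable_of_mem_interior_integrableExpSet h2
  have := Measure.isProbabilityMeasure_map hξm
  have hmgf := mgf_id_map hξm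
  have hcgf : cgf id (ν.map ξ) = cgf ξ ν := by ext t; simp only [cgf, hmgf]
  have h2' : (2 : ℝ) ∈ interior (integrableExpSet id (ν.map ξ)) := by
    rwa [integrableExpSet_eq_of_mgf hmgf]
  have h2i : Integrable (fun x => Real.exp (2 * id x)) (ν.map ξ) :=
    (interior_subset h2' : (2 : ℝ) ∈ integrableExpSet id (ν.map ξ))
  have := isProbabilityMeasure_tilted h2i
  have hL : MemLp id 2 ((ν.map ξ).tilted (2 * id ·)) := memLp_tilted_mul h2' 2
  obtain ⟨Ω', _, P, Y, -, hlaw, hindep, hP⟩ := exists_iid ℕ ((ν.map ξ).tilted (2 * id ·))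
  refine ⟨Ω', _, P, Y, hP, hindep, fun j => (hlaw j).aemeasurable, fun j => ?_, ?_, ?_, ?_⟩
  · rw [(hlaw j).map_eq, Measure.tilted]
    congr 1
    ext x
    rw [Real.exp_sub, exp_cgf (hξ 2 zero_le_two), ← hmgf]
    rfl
  · rw [← (hlaw 0).map_eq] at hL
    exact (memLp_map_measure_iff aestronglyMeasurable_id (hlaw 0).aemeasurable).1 hL
  · rw [(hlaw 0).variance_eq]
    intro h0
    refine hξ_nondeg ⟨∫ x, id x ∂((ν.map ξ).tilted (2 * id ·)), ?_⟩
    -- The law of ξ is absolutely continuous with respect to its tilting, so a degenerate tilted law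
    -- would make ξ degenerate.
    exact ae_of_ae_map hξm
      ((absolutelyContinuous_tilted h2i).ae_le (ae_eq_integral_of_variance_eq_zero hL h0))
  · rw [(hlaw 0).integral_eq, ← hcgf]
    exact integral_tilted_mul_self h2'

end ExponentialMoments

/-! ### Moments and characteristic function of a row -/

section RowMoments

variable {Ω Ω' : Type*} [MeasurableSpace Ω] [MeasurableSpace Ω'] {μ : Measure Ω}
  {ν : Measure Ω'} {ξ : Ω' → ℝ} {X : ℕ → ℕ → Ω → ℝ}

lemma integral_exp_mul_sum_row (hX : iIndepFun (fun p : ℕ × ℕ => X p.1 p.2) μ)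
    (hlaw : ∀ i j, IdentDistrib (X i j) ξ μ ν) (t : ℝ) (n i : ℕ) :
    ∫ ω, Real.exp (t * ∑ j ∈ Finset.range n, X i j ω) ∂μ = mgf ξ ν t ^ n := by
  have h := (iIndepFun_row hX i).mgf_sum₀ (t := t) (fun j => (hlaw i j).aemeasurable_fst)
    (Finset.range n)
  simp only [fun j => mgf_congr_of_identDistrib (X i j) ξ (hlaw i j) t, Finset.prod_const,
    Finset.card_range] at h
  rw [← h, mgf]
  simp

lemma integral_rowProduct (hX : iIndepFun (fun p : ℕ × ℕ => X p.1 p.2) μ)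
    (hlaw : ∀ i j, IdentDistrib (X i j) ξ μ ν) (n i : ℕ) :
    ∫ ω, rowProduct X n i ω ∂μ = mgf ξ ν 1 ^ n := by
  simpa [rowProduct] using integral_exp_mul_sum_row hX hlaw 1 n i

variable [IsProbabilityMeasure ν]

lemma integrable_exp_mul_sum_row (hX : iIndepFun (fun p : ℕ × ℕ => X p.1 p.2) μ)
    (hlaw : ∀ i j, IdentDistrib (X i j) ξ μ ν) {t : ℝ}
    (ht : Integrable (fun ω => Real.exp (t * ξ ω)) ν) (n i : ℕ) :
    Integrable (fun ω => Real.exp (t * ∑ j ∈ Finset.range n, X i j ω)) μ :=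
  -- A non-integrable function has integral 0 by convention, so the positive value of the integral
  -- already proves integrability.
  Integrable.of_integral_ne_zero <| by
    rw [integral_exp_mul_sum_row hX hlaw]
    exact (pow_pos (mgf_pos ht) n).ne'

lemma memLp_two_rowProduct (hX : iIndepFun (fun p : ℕ × ℕ => X p.1 p.2) μ)
    (hlaw : ∀ i j, IdentDistrib (X i j) ξ μ ν)
    (hξ : ∀ t : ℝ, 0 ≤ t → Integrable (fun ω => Real.exp (t * ξ ω)) ν) (n i : ℕ) :
    MemLp (rowProduct X n i) 2 μ := by
  rw [memLp_two_iff_integrable_sq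
    (aemeasurable_rowProduct (fun i j => (hlaw i j).aemeasurable_fst) n i).aestronglyMeasurable]
  simpa only [rowProduct, exp_two_mul_eq_sq] using
    integrable_exp_mul_sum_row hX hlaw (hξ 2 zero_le_two) n i

lemma memLp_two_sumOfProducts (hX : iIndepFun (fun p : ℕ × ℕ => X p.1 p.2) μ)
    (hlaw : ∀ i j, IdentDistrib (X i j) ξ μ ν)
    (hξ : ∀ t : ℝ, 0 ≤ t → Integrable (fun ω => Real.exp (t * ξ ω)) ν) (N : ℕ → ℕ) (n : ℕ) :
    MemLp (sumOfProducts X N n) 2 μ := by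
  rw [sumOfProducts_eq_sum_rowProduct]
  exact memLp_finsetSum _ fun i _ => memLp_two_rowProduct hX hlaw hξ n i

variable [IsProbabilityMeasure μ]

lemma variance_rowProduct (hX : iIndepFun (fun p : ℕ × ℕ => X p.1 p.2) μ)
    (hlaw : ∀ i j, IdentDistrib (X i j) ξ μ ν)
    (hξ : ∀ t : ℝ, 0 ≤ t → Integrable (fun ω => Real.exp (t * ξ ω)) ν) (n i : ℕ) :
    Var[rowProduct X n i; μ] = mgf ξ ν 2 ^ n - (mgf ξ ν 1 ^ n) ^ 2 := by
  rw [variance_eq_sub (memLp_two_rowProduct hX hlaw hξ n i), integral_rowProduct hX hlaw]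
  congr 1
  rw [← integral_exp_mul_sum_row hX hlaw 2 n i]
  simp [rowProduct, exp_two_mul_eq_sq]

lemma integral_sumOfProducts (hX : iIndepFun (fun p : ℕ × ℕ => X p.1 p.2) μ)
    (hlaw : ∀ i j, IdentDistrib (X i j) ξ μ ν)
    (hξ : ∀ t : ℝ, 0 ≤ t → Integrable (fun ω => Real.exp (t * ξ ω)) ν) (N : ℕ → ℕ) (n : ℕ) :
    ∫ ω, sumOfProducts X N n ω ∂μ = N n * mgf ξ ν 1 ^ n := by
  rw [sumOfProducts_eq_sum_rowProduct, integral_finsetSum _ fun i _ =>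
    (memLp_two_rowProduct hX hlaw hξ n i).integrable one_le_two]
  simp [integral_rowProduct hX hlaw]

lemma variance_sumOfProducts (hX : iIndepFun (fun p : ℕ × ℕ => X p.1 p.2) μ)
    (hlaw : ∀ i j, IdentDistrib (X i j) ξ μ ν)
    (hξ : ∀ t : ℝ, 0 ≤ t → Integrable (fun ω => Real.exp (t * ξ ω)) ν) (N : ℕ → ℕ) (n : ℕ) :
    Var[sumOfProducts X N n; μ] = N n * (mgf ξ ν 2 ^ n - (mgf ξ ν 1 ^ n) ^ 2) := by
  have h := IndepFun.variance_sum (s := Finset.range (N n))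
    (fun i _ => memLp_two_rowProduct hX hlaw hξ n i)
    (fun i _ k _ hik => indepFun_rowProduct hX (fun i j => (hlaw i j).aemeasurable_fst) n hik)
  rw [sumOfProducts_eq_sum_rowProduct]
  simp only [variance_rowProduct hX hlaw hξ, Finset.sum_const, Finset.card_range,
    nsmul_eq_mul] at h
  rw [← h]
  congr 1
  ext ω
  simp

/-- The characteristic function of a row product, expanded to first order, with the remainder
written under the tilted law. -/
lemma charFun_map_rowProduct {Ω'' : Type*} [MeasurableSpace Ω''] {P : Measure Ω''}
    [IsProbabilityMeasure P] {Y : ℕ → Ω'' → ℝ}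
    (hX : iIndepFun (fun p : ℕ × ℕ => X p.1 p.2) μ)
    (hlaw : ∀ i j, IdentDistrib (X i j) ξ μ ν)
    (hξ : ∀ t : ℝ, 0 ≤ t → Integrable (fun ω => Real.exp (t * ξ ω)) ν)
    (hY : iIndepFun Y P) (hYm : ∀ j, AEMeasurable (Y j) P)
    (htilt : ∀ j, (ν.map ξ).withDensity
      (fun x => ENNReal.ofReal (Real.exp (2 * x - cgf ξ ν 2))) = P.map (Y j))
    (t : ℝ) {s : ℝ} (hs : 0 < s) (n i : ℕ) :
    charFun (μ.map (rowProduct X n i)) (t / s) = 1 + (t * (mgf ξ ν 1 ^ n / s) : ℝ) * Complex.I +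
      (mgf ξ ν 2 ^ n / s ^ 2 : ℝ) *
        ∫ ω, scaledExpRemainder t (∑ j ∈ Finset.range n, Y j ω - Real.log s) ∂P := by
  have hXm := fun i j => (hlaw i j).aemeasurable_fst
  have hm := aemeasurable_rowProduct hXm n i
  have hint : Integrable (rowProduct X n i) μ :=
    (memLp_two_rowProduct hX hlaw hξ n i).integrable one_le_two
  have hM : 0 < mgf ξ ν 2 := mgf_pos (hξ 2 zero_le_two)
  rw [← integral_exp_smul_sum_range (iIndepFun_row hX i) (hXm i) hY hYm
    (fun j => by rw [(hlaw i j).map_eq]; exact htilt j) n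
    (G := fun x => scaledExpRemainder t (x - Real.log s))
    ((continuous_scaledExpRemainder t).measurable.comp (measurable_id.sub_const _)),
    ← integral_const_mul, charFun_apply_real, integral_map hm (by fun_prop)]
  have hpt : ∀ ω, Complex.exp ((t / s : ℝ) * (rowProduct X n i ω : ℝ) * Complex.I) =
      1 + (rowProduct X n i ω : ℂ) * ((t / s : ℝ) * Complex.I) +
        (mgf ξ ν 2 ^ n / s ^ 2 : ℝ) *
          (Real.exp (2 * (∑ j ∈ Finset.range n, X i j ω) - n * cgf ξ ν 2) •
            scaledExpRemainder t (∑ j ∈ Finset.range n, X i j ω - Real.log s)) := fun ω => by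
    set x := ∑ j ∈ Finset.range n, X i j ω with hx
    have h1 : rowProduct X n i ω = Real.exp x := rfl
    have h2 : Real.exp (x - Real.log s) = Real.exp x / s := by
      rw [Real.exp_sub, Real.exp_log hs]
    have h3 : Real.exp (2 * x - n * cgf ξ ν 2) = Real.exp x ^ 2 / mgf ξ ν 2 ^ n := by
      rw [Real.exp_sub, exp_two_mul_eq_sq, Real.exp_nat_mul, exp_cgf (hξ 2 zero_le_two)]
    rw [h1, h3, scaledExpRemainder, exp_two_mul_eq_sq, h2, Complex.real_smul]
    -- The tilting density supplies the square e^{2x} that `scaledExpRemainder` divides by; the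
    -- shift log s accounts for s².
    have h4 : ((mgf ξ ν 2 ^ n / s ^ 2 : ℝ) : ℂ) * (((Real.exp x ^ 2 / mgf ξ ν 2 ^ n : ℝ) : ℂ) *
        (expRemainder ((t * (Real.exp x / s) : ℝ) * Complex.I) / (((Real.exp x / s) ^ 2 : ℝ) : ℂ)))
        = expRemainder ((t * (Real.exp x / s) : ℝ) * Complex.I) := by
      have e1 : (mgf ξ ν 2 : ℂ) ≠ 0 := by exact_mod_cast hM.ne'
      have e2 : (s : ℂ) ≠ 0 := by exact_mod_cast hs.ne'
      have e3 : (Complex.exp x) ≠ 0 := Complex.exp_ne_zero _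
      push_cast
      field_simp
    rw [h4, expRemainder]
    have h5 : ((t / s : ℝ) : ℂ) * (Real.exp x : ℝ) * Complex.I =
        (t * (Real.exp x / s) : ℝ) * Complex.I := by push_cast; ring
    rw [h5]
    push_cast
    ring
  have hlin : Integrable (fun ω => (rowProduct X n i ω : ℂ) * ((t / s : ℝ) * Complex.I)) μ :=
    hint.ofReal.mul_const _
  have hexp : Integrable (fun ω =>
      Complex.exp ((t / s : ℝ) * (rowProduct X n i ω : ℝ) * Complex.I)) μ :=
    Integrable.of_bound (by fun_prop) 1 (Eventually.of_forall fun ω => by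
      rw [← Complex.ofReal_mul, Complex.norm_exp_ofReal_mul_I])
  have hconst : Integrable (fun ω => 1 + (rowProduct X n i ω : ℂ) * ((t / s : ℝ) * Complex.I)) μ :=
    (integrable_const _).add hlin
  have hrem := (hexp.sub hconst).congr (g := fun ω => (mgf ξ ν 2 ^ n / s ^ 2 : ℝ) *
          (Real.exp (2 * (∑ j ∈ Finset.range n, X i j ω) - n * cgf ξ ν 2) •
            scaledExpRemainder t (∑ j ∈ Finset.range n, X i j ω - Real.log s)))
    (Eventually.of_forall fun ω => by simp only [Pi.sub_apply, hpt ω]; ring)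
  simp only [hpt]
  rw [integral_add hconst hrem, integral_add (integrable_const _) hlin, integral_mul_const,
    integral_complex_ofReal, integral_rowProduct hX hlaw]
  simp
  ring

end RowMoments

/-! ### Growth of the number of rows and of the standard deviation -/

section Asymptotics

variable {c m κ r : ℝ} {N : ℕ → ℕ}

lemma tendsto_atTop_of_tendsto_exp_neg_mul (hc : 0 < c)
    (hN : Tendsto (fun n : ℕ => Real.exp (-c * n) * N n) atTop (𝓝 1)) : Tendsto N atTop atTop := by
  rw [← tendsto_natCast_atTop_iff (R := ℝ)]
  have h1 : Tendsto (fun n : ℕ => Real.exp (c * n)) atTop atTop :=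
    Real.tendsto_exp_atTop.comp (tendsto_natCast_atTop_atTop.const_mul_atTop hc)
  refine (hN.pos_mul_atTop one_pos h1).congr fun n => ?_
  rw [mul_right_comm, ← Real.exp_add]
  simp

/-- The logarithm of the standard deviation is asymptotic to `n m`, up to a vanishing error. -/
lemma tendsto_mul_sub_log_sqrt (hκ : c = 2 * m - κ) (hr0 : 0 ≤ r) (hr1 : r < 1)
    (hN : Tendsto (fun n : ℕ => Real.exp (-c * n) * N n) atTop (𝓝 1)) :
    Tendsto (fun n : ℕ => n * m - Real.log √(N n * (Real.exp κ ^ n * (1 - r ^ n)))) atTop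
      (𝓝 0) := by
  have h1 : Tendsto (fun n : ℕ => 1 - r ^ n) atTop (𝓝 1) := by
    simpa using (tendsto_pow_atTop_nhds_zero_of_lt_one hr0 hr1).const_sub 1
  have h2 := hN.mul h1
  rw [mul_one] at h2
  have h3 := ((Real.continuousAt_log one_ne_zero).tendsto.comp h2).const_mul (-(1 / 2))
  rw [Real.log_one, mul_zero] at h3
  -- Since c = 2m - κ, the difference equals -(1/2) log(e^{-cn} N_n (1 - r^n)) exactly.
  refine h3.congr' ?_
  filter_upwards [h2.eventually_ne one_ne_zero] with n hn
  have hN0 : (N n : ℝ) ≠ 0 := fun h => hn (by rw [h]; ring)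
  have hr : 1 - r ^ n ≠ 0 := fun h => hn (by rw [h]; ring)
  have hk : Real.exp κ ^ n ≠ 0 := (pow_pos (Real.exp_pos _) _).ne'
  have hv : 0 ≤ N n * (Real.exp κ ^ n * (1 - r ^ n)) := by
    have : r ^ n ≤ 1 := pow_le_one₀ hr0 hr1.le
    have := sub_nonneg.2 this
    positivity
  rw [Real.log_sqrt hv, Real.log_mul hN0 (mul_ne_zero hk hr), Real.log_mul hk hr, Function.comp,
    Real.log_mul (mul_ne_zero (Real.exp_pos _).ne' hN0) hr,
    Real.log_mul (Real.exp_pos _).ne' hN0, Real.log_exp, ← Real.exp_nat_mul, Real.log_exp, hκ]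
  ring

end Asymptotics

/-! ### Limit of the characteristic functions -/

lemma charFun_map_sub_div {Ω : Type*} [MeasurableSpace Ω] {μ : Measure Ω} {Z : Ω → ℝ}
    (hZ : AEMeasurable Z μ) (a s t : ℝ) :
    charFun (μ.map fun ω => (Z ω - a) / s) t =
      Complex.exp (-(t * (a / s) : ℝ) * Complex.I) * charFun (μ.map Z) (t / s) := by
  rw [charFun_apply_real, charFun_apply_real, integral_map (by fun_prop) (by fun_prop),
    integral_map hZ (by fun_prop), ← integral_const_mul]
  refine integral_congr_ae (Eventually.of_forall fun ω => ?_)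
  simp only [← Complex.exp_add]
  congr 1
  push_cast
  ring

/-- Passing to the limit in an `N`-th power of characteristic functions expanded to first order. -/
lemma tendsto_exp_neg_mul_one_add_pow {N : ℕ → ℕ} (hN : Tendsto N atTop atTop) {θ : ℕ → ℝ}
    (hθ : Tendsto (fun n => N n * θ n ^ 2) atTop (𝓝 0)) {k : ℕ → ℂ} {w : ℂ}
    (hk : Tendsto (fun n => (N n : ℂ) * k n) atTop (𝓝 w)) :
    Tendsto (fun n => (Complex.exp (-(θ n : ℝ) * Complex.I) *
      (1 + (θ n : ℝ) * Complex.I + k n)) ^ N n) atTop (𝓝 (Complex.exp w)) := by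
  have hθ0 : Tendsto θ atTop (𝓝 0) := by
    have h1 : Tendsto (fun n => θ n ^ 2) atTop (𝓝 0) := by
      refine squeeze_zero' (Eventually.of_forall fun n => sq_nonneg _) ?_ hθ
      filter_upwards [hN.eventually_ge_atTop 1] with n hn
      have : (1 : ℝ) ≤ N n := by exact_mod_cast hn
      nlinarith [sq_nonneg (θ n)]
    have h2 := (Real.continuous_sqrt.tendsto 0).comp h1
    simp only [Real.sqrt_zero, Function.comp_def, Real.sqrt_sq_eq_abs] at h2
    exact (tendsto_zero_iff_abs_tendsto_zero θ).2 h2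
  have hE : Tendsto (fun n => Complex.exp (-(θ n : ℝ) * Complex.I)) atTop (𝓝 1) := by
    have h : Continuous fun x : ℝ => Complex.exp (-(x : ℂ) * Complex.I) := by fun_prop
    simpa [Function.comp_def] using (h.tendsto 0).comp hθ0
  have hR : Tendsto (fun n => (N n : ℂ) * (Complex.exp (-(θ n : ℝ) * Complex.I) *
      expRemainder ((θ n : ℝ) * Complex.I))) atTop (𝓝 0) := by
    have h3 := hθ.const_mul 3
    rw [mul_zero] at h3
    refine squeeze_zero_norm (fun n => ?_) h3
    rw [norm_mul, norm_mul, ← Complex.ofReal_neg, Complex.norm_exp_ofReal_mul_I, one_mul,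
      Complex.norm_natCast]
    have := mul_le_mul_of_nonneg_left (norm_expRemainder_ofReal_mul_I_le (θ n))
      (Nat.cast_nonneg (α := ℝ) (N n))
    linarith
  have hmain := (hE.mul hk).sub hR
  rw [one_mul, sub_zero] at hmain
  -- Replacing 1 + iθ by e^{iθ} minus its remainder cancels the centring phase and leaves an error
  -- of order N θ².
  have hg : ∀ n, Complex.exp (-(θ n : ℝ) * Complex.I) * ((N n : ℂ) * k n) -
      (N n : ℂ) * (Complex.exp (-(θ n : ℝ) * Complex.I) * expRemainder ((θ n : ℝ) * Complex.I)) =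
      (N n : ℂ) * (Complex.exp (-(θ n : ℝ) * Complex.I) *
        (1 + (θ n : ℝ) * Complex.I + k n) - 1) := fun n => by
    have h : Complex.exp (-(θ n : ℝ) * Complex.I) * Complex.exp ((θ n : ℝ) * Complex.I) = 1 := by
      rw [← Complex.exp_add]; simp
    rw [expRemainder]
    linear_combination (-(N n : ℂ)) * h
  simpa only [add_sub_cancel] using Complex.tendsto_one_add_pow_exp hN (hmain.congr hg)

theorem theorem2 {Ω Ω' : Type*} [MeasurableSpace Ω] [MeasurableSpace Ω']
    (μ : Measure Ω) [IsProbabilityMeasure μ] (ν : Measure Ω') [IsProbabilityMeasure ν]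
    (ξ : Ω' → ℝ)
    (hξ_nondeg : ¬ ∃ a : ℝ, ∀ᵐ ω ∂ν, ξ ω = a)
    (hξ_exp : ∀ t : ℝ, 0 ≤ t → Integrable (fun ω => Real.exp (t * ξ ω)) ν)
    (X : ℕ → ℕ → Ω → ℝ)
    (hX_indep : iIndepFun (fun p : ℕ × ℕ => X p.1 p.2) μ)
    (hX_law : ∀ i j, IdentDistrib (X i j) ξ μ ν)
    (c : ℝ) (hc_pos : 0 < c) (N : ℕ → ℕ)
    (hN : Tendsto (fun n : ℕ => Real.exp (-c * n) * N n) atTop (𝓝 1))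
    (hc : (c : EReal) = criticalPointTwo ξ ν) :
    (∀ n, MemLp (sumOfProducts X N n) 2 μ) ∧
    (∀ᶠ n in atTop, 0 < Var[sumOfProducts X N n; μ]) ∧
    TendstoInDistribution
      (fun n ω => (sumOfProducts X N n ω - ∫ ω', sumOfProducts X N n ω' ∂μ) /
        √(Var[sumOfProducts X N n; μ]))
      atTop (id : ℝ → ℝ) (fun _ => μ) (gaussianReal 0 (1 / 2)) := by
  rw [criticalPointTwo_eq hξ_exp, EReal.coe_eq_coe_iff] at hc
  have hXm := fun i j => (hX_law i j).aemeasurable_fst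
  have hM : 0 < mgf ξ ν 2 := mgf_pos (hξ_exp 2 zero_le_two)
  have hexp : Real.exp (cgf ξ ν 2) = mgf ξ ν 2 := exp_cgf (hξ_exp 2 zero_le_two)
  have hNtop := tendsto_atTop_of_tendsto_exp_neg_mul hc_pos hN
  set r := mgf ξ ν 1 ^ 2 / mgf ξ ν 2 with hr
  have hr0 : 0 ≤ r := by positivity
  have hr1 : r < 1 := (div_lt_one hM).2 (mgf_one_sq_lt_mgf_two hξ_nondeg hξ_exp)
  have hrn : Tendsto (fun n : ℕ => r ^ n) atTop (𝓝 0) :=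
    tendsto_pow_atTop_nhds_zero_of_lt_one hr0 hr1
  have hrM : ∀ n : ℕ, (mgf ξ ν 1 ^ n) ^ 2 = mgf ξ ν 2 ^ n * r ^ n := fun n => by
    rw [← mul_pow, hr, mul_div_cancel₀ _ hM.ne', ← pow_mul, ← pow_mul, mul_comm]
  have hvar : ∀ n, Var[sumOfProducts X N n; μ] = N n * (mgf ξ ν 2 ^ n * (1 - r ^ n)) := fun n => by
    rw [variance_sumOfProducts hX_indep hX_law hξ_exp, hrM]
    ring
  have hLp := memLp_two_sumOfProducts hX_indep hX_law hξ_exp N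
  have hgood : ∀ᶠ n in atTop, 0 < N n ∧ 0 < 1 - r ^ n := by
    filter_upwards [hNtop.eventually_gt_atTop 0, eventually_ge_atTop 1] with n h1 h2
    exact ⟨h1, sub_pos.2 (pow_lt_one₀ hr0 hr1 (by omega))⟩
  have hpos : ∀ᶠ n in atTop, 0 < Var[sumOfProducts X N n; μ] := by
    filter_upwards [hgood] with n ⟨h1, h2⟩
    rw [hvar]
    have : (0 : ℝ) < N n := by exact_mod_cast h1
    positivity
  refine ⟨hLp, hpos, fun n => ((hLp n).aemeasurable.sub_const _).div_const _, aemeasurable_id, ?_⟩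
  refine ProbabilityMeasure.tendsto_iff_tendsto_charFun.2 fun t => ?_
  obtain ⟨Ω'', _, P, Y, hP, hY, hYm, htilt, hY2, hYvar, hYmean⟩ :=
    exists_iid_tilted hξ_nondeg hξ_exp
  have hident : ∀ i, IdentDistrib (Y i) (Y 0) P P := fun i =>
    ⟨hYm i, hYm 0, by rw [← htilt i, ← htilt 0]⟩
  set s : ℕ → ℝ := fun n => √Var[sumOfProducts X N n; μ] with hs
  have hs2 : ∀ n, s n ^ 2 = N n * (mgf ξ ν 2 ^ n * (1 - r ^ n)) := fun n => by
    rw [hs, Real.sq_sqrt (variance_nonneg _ _), hvar]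
  have hdrift : Tendsto (fun n : ℕ => n * P[Y 0] - Real.log (s n)) atTop (𝓝 0) := by
    simpa only [hs, hvar, hYmean, hexp] using tendsto_mul_sub_log_sqrt hc hr0 hr1 hN
  have hJ := tendsto_integral_comp_sum_sub hY2 hYvar hY hident hdrift
    (continuous_scaledExpRemainder t).measurable (norm_scaledExpRemainder_le t)
    (tendsto_scaledExpRemainder_atBot t) (tendsto_scaledExpRemainder_atTop t)
  have hratio : Tendsto (fun n : ℕ => (1 - r ^ n)⁻¹) atTop (𝓝 1) := by
    simpa using (hrn.const_sub 1).inv₀ (by simp)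
  -- The quantity equals t² r^n / (1 - r^n) for large n.
  have hθ : Tendsto (fun n => N n * (t * (mgf ξ ν 1 ^ n / s n)) ^ 2) atTop (𝓝 0) := by
    have h := (hrn.mul hratio).const_mul (t ^ 2)
    rw [zero_mul, mul_zero] at h
    refine h.congr' ?_
    filter_upwards [hgood] with n ⟨h1, h2⟩
    have h3 : (N n : ℝ) ≠ 0 := by exact_mod_cast h1.ne'
    have h4 := (pow_pos hM n).ne'
    rw [mul_pow t, div_pow (mgf ξ ν 1 ^ n), hs2, hrM]
    clear_value r
    field_simp
  have hk : Tendsto (fun n => (N n : ℂ) * ((mgf ξ ν 2 ^ n / s n ^ 2 : ℝ) *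
      ∫ ω, scaledExpRemainder t (∑ j ∈ Finset.range n, Y j ω - Real.log (s n)) ∂P)) atTop
      (𝓝 (-t ^ 2 / 4)) := by
    have h := ((Complex.continuous_ofReal.tendsto _).comp hratio).mul hJ
    -- The average of the limits -t²/2 and 0 is where the variance 1/2 appears.
    have e : ((1 : ℝ) : ℂ) * ((-(t : ℂ) ^ 2 / 2 + 0) / 2) = -(t : ℂ) ^ 2 / 4 := by
      push_cast; ring
    rw [e] at h
    refine h.congr' ?_
    filter_upwards [hgood] with n ⟨h1, h2⟩
    have h3 : (N n : ℝ) ≠ 0 := by exact_mod_cast h1.ne'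
    have h4 := (pow_pos hM n).ne'
    rw [← mul_assoc, ← Complex.ofReal_natCast, ← Complex.ofReal_mul, hs2]
    have h5 : (N n : ℝ) * (mgf ξ ν 2 ^ n / (N n * (mgf ξ ν 2 ^ n * (1 - r ^ n)))) =
        (1 - r ^ n)⁻¹ := by field_simp
    rw [h5, Function.comp]
  have hlim := tendsto_exp_neg_mul_one_add_pow hNtop hθ hk
  have hgauss : charFun ((gaussianReal 0 (1 / 2)).map id) t = Complex.exp (-(t : ℂ) ^ 2 / 4) := by
    rw [Measure.map_id, charFun_gaussianReal]
    congr 1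
    push_cast
    ring
  simp only [ProbabilityMeasure.coe_mk, hgauss]
  refine hlim.congr' ?_
  filter_upwards [hpos] with n hn
  have hsn : 0 < √Var[sumOfProducts X N n; μ] := Real.sqrt_pos.2 hn
  rw [charFun_map_sub_div (hLp n).aemeasurable, sumOfProducts_eq_sum_rowProduct,
    charFun_map_sum_rowProduct hX_indep hXm, ← sumOfProducts_eq_sum_rowProduct,
    integral_sumOfProducts hX_indep hX_law hξ_exp, Finset.prod_congr rfl fun i _ =>
      charFun_map_rowProduct hX_indep hX_law hξ_exp hY hYm htilt t hsn n i,
    Finset.prod_const, Finset.card_range, mul_pow, ← Complex.exp_nat_mul]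
  congr 2
  push_cast
  ring
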